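/- **Theorem (Hardness of Quantum Threshold Search).** Let $n\ge 1$. For an $n$-qubit state $\rho$, a $\mathsf{QStat}_\rho$ query consists of a Hermitian observable $O$ with operator norm $\|O\|_\infty\le 1$ and a tolerance $t\ge 0$, and is answered by some real number $a$ with $|a-\mathrm{Tr}(O\rho)|\le t$; an algorithm may be randomized and adaptive, and its guarantees have to hold however the oracle chooses its admissible answers. Let $P_1,\dots,P_{4^n-1}$ be the non-identity $n$-qubit Pauli strings. For $0<\epsilon,\delta<\tfrac12$, *enhanced quantum threshold search* for these observables is the following problem: given thresholds $\theta_1,\dots,\theta_{4^n-1}\in[0,1]$ and access to $\mathsf{QStat}_\rho$ for an unknown $n$-qubit state $\rho$, output either - "$|\mathrm{Tr}(P_j\rho)-\theta_j|>\tfrac34\epsilon$ and $|\mathrm{Tr}(P_j\rho)-\mu'_j|\le\tfrac14\epsilon$" for some particular $j$ and value $\mu'_j$, or - "$|\mathrm{Tr}(P_i\rho)-\theta_i|\le\epsilon$ for all $i$", such that the output is false with probability at most $\delta$. For every $0<\delta<\tfrac12$ there is a constant $c>0$, depending only on $\delta$, such that for all $n\ge1$, $\tau>0$ and $0<\epsilon<\tfrac12$: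 if an algorithm uses only $\mathsf{QStat}_\rho$ queries of tolerance at least $\tau$, makes at most $q$ of them, and solves enhanced quantum threshold search for all the non-identity Pauli strings, for every $n$-qubit state $\rho$ and every choice of thresholds, with probability of a false output at most $\delta$, then $$q\;\ge\; c\,\frac{\tau^2\,2^{2n}}{n},$$ that is, $\Omega(\tau^2 2^{2n}/n)$ queries are required. -/

import Mathlib

open MeasureTheory
open scoped ComplexOrder

/-- Operators on `n` qubits, in the computational basis indexed by bit strings. -/
abbrev QubitOp (n : ℕ) : Type := Matrix (Fin n → Fin 2) (Fin n → Fin 2) ℂ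

/-- An `n`-qubit (mixed) quantum state: a positive semidefinite operator of trace one. -/
def IsQState {n : ℕ} (ρ : QubitOp n) : Prop :=
  ρ.PosSemidef ∧ ρ.trace = 1

/-- The expectation value `Tr(O ρ)` of a Hermitian observable `O` in the state `ρ`
(a real number when `O` and `ρ` are Hermitian). -/
noncomputable def expVal {n : ℕ} (O ρ : QubitOp n) : ℝ :=
  (O * ρ).trace.re

/-- The labels of the four single-qubit Pauli operators. -/
inductive PauliLabel : Type
  | I | X | Y | Z

/-- The four single-qubit Pauli matrices. -/
noncomputable def PauliLabel.toMatrix : PauliLabel → Matrix (Fin 2) (Fin 2) ℂ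
  | .I => !![1, 0; 0, 1]
  | .X => !![0, 1; 1, 0]
  | .Y => !![0, -Complex.I; Complex.I, 0]
  | .Z => !![1, 0; 0, -1]

/-- The Pauli string `P 0 ⊗ P 1 ⊗ ⋯ ⊗ P (n - 1)`: the entries of a tensor product are the products
of the entries of the factors. -/
noncomputable def pauliString {n : ℕ} (P : Fin n → PauliLabel) : QubitOp n :=
  Matrix.of fun x y => ∏ i, (P i).toMatrix (x i) (y i)

/-- The (labels of the) `4 ^ n - 1` Pauli strings on `n` qubits other than the identity. -/
abbrev NonIdPauli (n : ℕ) : Type :=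
  {P : Fin n → PauliLabel // P ≠ fun _ => PauliLabel.I}

/-- A quantum statistical query: an observable of operator norm at most one and a tolerance. -/
structure QStatQuery (n : ℕ) where
  obs : QubitOp n
  obs_isHermitian : obs.IsHermitian
  obs_norm_le : ‖Matrix.toEuclideanCLM (𝕜 := ℂ) obs‖ ≤ 1
  tol : ℝ
  tol_nonneg : 0 ≤ tol

/-- `r` is an admissible way for the oracle `QStat_ρ` to answer queries: every answer is within the
tolerance of the query from the true expectation value. -/
def IsQStatOracle {n : ℕ} (ρ : QubitOp n) (r : QStatQuery n → ℝ) : Prop :=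
  ∀ Q : QStatQuery n, |r Q - expVal Q.obs ρ| ≤ Q.tol

/-- A deterministic adaptive algorithm with statistical queries, as a decision tree: it either stops
with an output in `α`, or makes a query and continues depending on the real number it receives. -/
inductive QSQTree (n : ℕ) (α : Type) : Type
  | output (a : α) : QSQTree n α
  | query (Q : QStatQuery n) (next : ℝ → QSQTree n α) : QSQTree n α

namespace QSQTree

/-- The output of the algorithm when the queries are answered by `r`. -/
def run {n : ℕ} {α : Type} (r : QStatQuery n → ℝ) : QSQTree n α → α
  | output a => a
  | query Q next => (next (r Q)).run r

/-- The list of all queries that the algorithm makes when the queries are answered by `r`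
(a query that is repeated is listed, hence counted, every time). -/
def queries {n : ℕ} {α : Type} (r : QStatQuery n → ℝ) : QSQTree n α → List (QStatQuery n)
  | output _ => []
  | query Q next => Q :: (next (r Q)).queries r

end QSQTree

/-- A choice of thresholds in `[0, 1]`, one for each non-identity Pauli string. -/
abbrev Thresholds (n : ℕ) : Type := NonIdPauli n → Set.Icc (0 : ℝ) 1

/-- The possible outputs of enhanced quantum threshold search for the non-identity Pauli strings. -/
inductive ThresholdOutput (n : ℕ) : Type
  /-- The claim that the expectation value of `j` is far from its threshold and close to `μ`. -/
  | deviates (j : NonIdPauli n) (μ : ℝ) : ThresholdOutput n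
  /-- The claim that all the expectation values are close to their thresholds. -/
  | allClose : ThresholdOutput n

/-- The output is true for the state `ρ`, the thresholds `θ` and the accuracy `ε`. -/
def ThresholdOutput.IsTrue {n : ℕ} (ε : ℝ) (θ : Thresholds n) (ρ : QubitOp n) :
    ThresholdOutput n → Prop
  | .deviates j μ =>
      |expVal (pauliString j.1) ρ - θ j| > 3 / 4 * ε ∧
        |expVal (pauliString j.1) ρ - μ| ≤ 1 / 4 * ε
  | .allClose => ∀ i : NonIdPauli n, |expVal (pauliString i.1) ρ - θ i| ≤ ε

/-- A randomized algorithm for threshold search is a family `A θ ω` of decision trees, where `θ` is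
the input and `ω` is the internal randomness, of law `ν`.  It solves enhanced quantum threshold
search with accuracy `ε` if for all thresholds, all states and all admissible oracles, the
probability of a false output is at most `δ`.  (If the event of a false output is not measurable,
then this refers to its outer measure.) -/
def SolvesThresholdSearch {n : ℕ} {Ω : Type*} [MeasurableSpace Ω] (ν : Measure Ω) (ε δ : ℝ)
    (A : Thresholds n → Ω → QSQTree n (ThresholdOutput n)) : Prop :=
  ∀ (θ : Thresholds n) (ρ : QubitOp n), IsQState ρ →
    ∀ r : QStatQuery n → ℝ, IsQStatOracle ρ r →
      ν {ω | ¬ ((A θ ω).run r).IsTrue ε θ ρ} ≤ ENNReal.ofReal δ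

/-- Every query that the algorithm ever makes to an admissible oracle of a quantum state has
tolerance at least `τ`. -/
def HasToleranceAtLeast {n : ℕ} {Ω : Type*} (τ : ℝ)
    (A : Thresholds n → Ω → QSQTree n (ThresholdOutput n)) : Prop :=
  ∀ (θ : Thresholds n) (ω : Ω) (ρ : QubitOp n), IsQState ρ →
    ∀ r : QStatQuery n → ℝ, IsQStatOracle ρ r → ∀ Q ∈ (A θ ω).queries r, τ ≤ Q.tol

/-- The algorithm never makes more than `q` queries to an admissible oracle of a quantum state. -/
def MakesAtMostQueries {n : ℕ} {Ω : Type*} (q : ℕ)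
    (A : Thresholds n → Ω → QSQTree n (ThresholdOutput n)) : Prop :=
  ∀ (θ : Thresholds n) (ω : Ω) (ρ : QubitOp n), IsQState ρ →
    ∀ r : QStatQuery n → ℝ, IsQStatOracle ρ r → ((A θ ω).queries r).length ≤ q

/-! The lower bound comes from distinguishing the maximally mixed state `1 / 2 ^ n` from the states
`(1 + P) / 2 ^ n`, where `P` is a non-identity Pauli string, with all thresholds equal to zero.
For the maximally mixed state all expectation values of Pauli strings vanish, so that "all close" is
the only true output; for `(1 + P) / 2 ^ n` the expectation value of `P` is one, so that "all close"
is false.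

Let the oracle answer every query as for the maximally mixed state whenever this is admissible. Then
a query of tolerance at least `τ` with observable `O` can only reveal those `P` for which
`|Tr(O P)| / 2 ^ n > τ`. The Pauli strings are orthogonal for the Hilbert-Schmidt inner product, so
by Bessel's inequality and `‖O‖ ≤ 1` there are at most `1 / τ ^ 2` of them
(`sum_sq_pauliCoeff_le_one`). An execution with `q` queries therefore ends with the same output
as on the maximally mixed state for all but `q / τ ^ 2` of the Pauli strings
(`sq_mul_card_run_ne_le`). Averaging the probabilities of false outputs over the Pauli strings
(`card_le_of_forall_measure_le`) shows that `(1 - 2 * δ) * (4 ^ n - 1) ≤ q / τ ^ 2`, which is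
stronger than the claim by a factor of order `n`. -/

/-! ### Pauli strings -/

instance : Fintype PauliLabel :=
  ⟨⟨([.I, .X, .Y, .Z] : List PauliLabel), by simp⟩, fun x => by cases x <;> simp⟩

theorem card_pauliLabel : Fintype.card PauliLabel = 4 := rfl

theorem PauliLabel.toMatrix_isHermitian (a : PauliLabel) : a.toMatrix.IsHermitian := by
  ext i j
  cases a <;> fin_cases i <;> fin_cases j <;> simp [toMatrix]

theorem PauliLabel.toMatrix_mul_self (a : PauliLabel) : a.toMatrix * a.toMatrix = 1 := by
  ext i j
  cases a <;> fin_cases i <;> fin_cases j <;> simp [toMatrix, Matrix.mul_apply]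

theorem PauliLabel.trace_toMatrix_mul_of_ne {a b : PauliLabel} (h : a ≠ b) :
    (a.toMatrix * b.toMatrix).trace = 0 := by
  cases a <;> cases b <;> first
    | exact absurd rfl h
    | simp [toMatrix, Matrix.trace]

theorem pauliString_mul_apply {n : ℕ} (P Q : Fin n → PauliLabel) (x y : Fin n → Fin 2) :
    (pauliString P * pauliString Q) x y =
      ∏ i, ((P i).toMatrix * (Q i).toMatrix) (x i) (y i) := by
  simp only [Matrix.mul_apply, pauliString, Matrix.of_apply, ← Finset.prod_mul_distrib]
  rw [Finset.prod_univ_sum, Fintype.piFinset_univ]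

theorem trace_pauliString_mul {n : ℕ} (P Q : Fin n → PauliLabel) :
    (pauliString P * pauliString Q).trace = ∏ i, ((P i).toMatrix * (Q i).toMatrix).trace := by
  simp only [Matrix.trace, Matrix.diag_apply, pauliString_mul_apply]
  rw [Finset.prod_univ_sum, Fintype.piFinset_univ]

theorem pauliString_isHermitian {n : ℕ} (P : Fin n → PauliLabel) :
    (pauliString P).IsHermitian := by
  ext x y
  simp only [Matrix.conjTranspose_apply, pauliString, Matrix.of_apply, star_prod]
  exact Finset.prod_congr rfl fun i _ => (P i).toMatrix_isHermitian.apply (x i) (y i)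

theorem pauliString_mul_self {n : ℕ} (P : Fin n → PauliLabel) :
    pauliString P * pauliString P = 1 := by
  ext x y
  rw [pauliString_mul_apply]
  simp only [PauliLabel.toMatrix_mul_self, Matrix.one_apply]
  rw [Finset.prod_ite_zero]
  simp [funext_iff]

theorem pauliString_const_I {n : ℕ} : pauliString (fun _ : Fin n => PauliLabel.I) = 1 := by
  have hI : PauliLabel.I.toMatrix = 1 := Matrix.one_fin_two.symm
  ext x y
  simp only [pauliString, Matrix.of_apply, hI, Matrix.one_apply]
  rw [Finset.prod_ite_zero]
  simp [funext_iff]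

theorem trace_pauliString_mul_of_ne {n : ℕ} {P Q : Fin n → PauliLabel} (h : P ≠ Q) :
    (pauliString P * pauliString Q).trace = 0 := by
  obtain ⟨i, hi⟩ := Function.ne_iff.1 h
  rw [trace_pauliString_mul]
  exact Finset.prod_eq_zero (Finset.mem_univ i) (PauliLabel.trace_toMatrix_mul_of_ne hi)

theorem trace_one_qubitOp {n : ℕ} : (1 : QubitOp n).trace = 2 ^ n := by
  simp [Matrix.trace_one]

theorem trace_pauliString_mul_self {n : ℕ} (P : Fin n → PauliLabel) :
    (pauliString P * pauliString P).trace = 2 ^ n := by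
  rw [pauliString_mul_self, trace_one_qubitOp]

theorem trace_pauliString {n : ℕ} (P : NonIdPauli n) : (pauliString P.1).trace = 0 := by
  simpa [pauliString_const_I] using trace_pauliString_mul_of_ne P.2

noncomputable instance (n : ℕ) : Fintype (NonIdPauli n) := Fintype.ofFinite _

theorem card_nonIdPauli (n : ℕ) : Fintype.card (NonIdPauli n) = 4 ^ n - 1 := by
  classical
  rw [Fintype.card_subtype_compl, Fintype.card_subtype_eq, Fintype.card_fun, Fintype.card_fin,
    card_pauliLabel]

/-! ### Bessel's inequality for Pauli coefficients -/

/-- The Hilbert-Schmidt coefficient `Tr(O P) / 2 ^ n` of an observable `O` along the Pauli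
string `P`. -/
noncomputable def pauliCoeff {n : ℕ} (O : QubitOp n) (P : NonIdPauli n) : ℝ :=
  (O * pauliString P.1).trace.re / 2 ^ n

/-- The entries of a matrix, as a vector whose Euclidean norm is the Hilbert-Schmidt norm. -/
noncomputable def hsVec {n : ℕ} (M : QubitOp n) :
    EuclideanSpace ℂ ((Fin n → Fin 2) × (Fin n → Fin 2)) :=
  WithLp.toLp 2 fun p => M p.1 p.2

theorem inner_hsVec {n : ℕ} {M : QubitOp n} (hM : M.IsHermitian) (N : QubitOp n) :
    inner ℂ (hsVec M) (hsVec N) = (N * M).trace := by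
  simp only [hsVec, PiLp.inner_apply, Matrix.trace, Matrix.diag_apply, Matrix.mul_apply,
    Fintype.sum_prod_type, RCLike.inner_apply]
  refine Finset.sum_congr rfl fun x _ => Finset.sum_congr rfl fun y _ => ?_
  congr 1
  exact hM.apply y x

/-- Each of the `2 ^ n` columns of an operator of norm at most one has Euclidean norm at most
one. -/
theorem norm_hsVec_sq_le {n : ℕ} {O : QubitOp n}
    (hO : ‖Matrix.toEuclideanCLM (𝕜 := ℂ) O‖ ≤ 1) : ‖hsVec O‖ ^ 2 ≤ 2 ^ n := by
  have hcol : ∀ y, ∑ x, ‖O x y‖ ^ 2 ≤ 1 := fun y => by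
    have h := (Matrix.toEuclideanCLM (𝕜 := ℂ) O).le_of_opNorm_le hO (EuclideanSpace.single y 1)
    have h2 : ‖Matrix.toEuclideanCLM (𝕜 := ℂ) O (EuclideanSpace.single y 1)‖ ^ 2 ≤ 1 :=
      pow_le_one₀ (norm_nonneg _) (by simpa using h)
    rw [EuclideanSpace.norm_sq_eq] at h2
    simpa [Matrix.ofLp_toEuclideanCLM] using h2
  rw [EuclideanSpace.norm_sq_eq, Fintype.sum_prod_type, Finset.sum_comm]
  calc _ ≤ ∑ _y : Fin n → Fin 2, (1 : ℝ) := Finset.sum_le_sum fun y _ => hcol y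
    _ = 2 ^ n := by simp

theorem orthonormal_hsVec_pauliString (n : ℕ) :
    Orthonormal ℂ fun P : NonIdPauli n => ((√(2 ^ n) : ℝ) : ℂ)⁻¹ • hsVec (pauliString P.1) := by
  classical
  have hs : ((√(2 ^ n) : ℝ) : ℂ) * ((√(2 ^ n) : ℝ) : ℂ) = 2 ^ n := by
    rw [← Complex.ofReal_mul, Real.mul_self_sqrt (by positivity)]
    simp
  rw [orthonormal_iff_ite]
  intro P Q
  rw [inner_smul_left, inner_smul_right, inner_hsVec (pauliString_isHermitian _), map_inv₀,
    Complex.conj_ofReal, ← mul_assoc, ← mul_inv, hs]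
  split_ifs with h
  · rw [h, trace_pauliString_mul_self, inv_mul_cancel₀ (by positivity)]
  · rw [trace_pauliString_mul_of_ne fun h' => h (Subtype.ext h'.symm), mul_zero]

theorem sum_sq_pauliCoeff_le_one {n : ℕ} {O : QubitOp n}
    (hO : ‖Matrix.toEuclideanCLM (𝕜 := ℂ) O‖ ≤ 1) : ∑ P, pauliCoeff O P ^ 2 ≤ 1 := by
  have hd : (0 : ℝ) < 2 ^ n := by positivity
  have hB := ((orthonormal_hsVec_pauliString n).sum_inner_products_le (hsVec O)
    (s := Finset.univ)).trans (norm_hsVec_sq_le hO)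
  have hle : ∀ P : NonIdPauli n, 2 ^ n * pauliCoeff O P ^ 2 ≤
      ‖inner ℂ (((√(2 ^ n) : ℝ) : ℂ)⁻¹ • hsVec (pauliString P.1)) (hsVec O)‖ ^ 2 := fun P => by
    rw [inner_smul_left, inner_hsVec (pauliString_isHermitian _), norm_mul, mul_pow, map_inv₀,
      Complex.conj_ofReal, norm_inv, Complex.norm_real, inv_pow, Real.norm_eq_abs, sq_abs,
      Real.sq_sqrt hd.le, pauliCoeff, div_pow]
    have h := sq_le_sq' (neg_le_of_abs_le (Complex.abs_re_le_norm _))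
      (le_of_abs_le (Complex.abs_re_le_norm (O * pauliString P.1).trace))
    calc _ = (2 ^ n)⁻¹ * (O * pauliString P.1).trace.re ^ 2 := by field_simp
      _ ≤ _ := by gcongr
  have h := (Finset.sum_le_sum fun P _ => hle P).trans hB
  rw [← Finset.mul_sum] at h
  exact le_of_mul_le_mul_left (by simpa using h) hd

/-! ### The states to be distinguished -/

/-- The maximally mixed state `1 / 2 ^ n`. -/
noncomputable def maxMixed (n : ℕ) : QubitOp n := ((2 : ℝ) ^ n)⁻¹ • 1

/-- The state `(1 + P) / 2 ^ n`, the normalized projection onto the `+1` eigenspace of `P`. -/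
noncomputable def pauliState {n : ℕ} (P : NonIdPauli n) : QubitOp n :=
  ((2 : ℝ) ^ n)⁻¹ • (1 + pauliString P.1)

theorem isQState_maxMixed (n : ℕ) : IsQState (maxMixed n) := by
  refine ⟨Matrix.PosSemidef.one.smul (by positivity), ?_⟩
  rw [maxMixed, Matrix.trace_smul, trace_one_qubitOp, Complex.real_smul]
  simp

theorem isQState_pauliState {n : ℕ} (P : NonIdPauli n) : IsQState (pauliState P) := by
  refine ⟨Matrix.PosSemidef.smul ?_ (by positivity), ?_⟩
  · -- As `P` is a Hermitian involution, `1 + P` is half of its own square.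
    have h : 1 + pauliString P.1 =
        (2⁻¹ : ℝ) • ((1 + pauliString P.1).conjTranspose * (1 + pauliString P.1)) := by
      rw [Matrix.conjTranspose_add, Matrix.conjTranspose_one, (pauliString_isHermitian P.1).eq,
        add_mul, mul_add, mul_add, pauliString_mul_self, one_mul, one_mul, mul_one,
        add_comm (pauliString P.1) 1, ← two_smul ℝ, smul_smul]
      norm_num
    rw [h]
    exact (Matrix.posSemidef_conjTranspose_mul_self _).smul (by positivity)
  · rw [pauliState, Matrix.trace_smul, Matrix.trace_add, trace_one_qubitOp, trace_pauliString,
      Complex.real_smul]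
    simp

theorem expVal_maxMixed_pauliString {n : ℕ} (P : NonIdPauli n) :
    expVal (pauliString P.1) (maxMixed n) = 0 := by
  simp [expVal, maxMixed, trace_pauliString]

theorem expVal_pauliState {n : ℕ} (O : QubitOp n) (P : NonIdPauli n) :
    expVal O (pauliState P) = expVal O (maxMixed n) + pauliCoeff O P := by
  simp only [expVal, pauliState, maxMixed, pauliCoeff, mul_add, smul_add, Matrix.mul_smul,
    Matrix.trace_add, Matrix.trace_smul, Complex.add_re, Complex.smul_re, smul_eq_mul]
  ring

theorem expVal_pauliState_pauliString {n : ℕ} (P : NonIdPauli n) :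
    expVal (pauliString P.1) (pauliState P) = 1 := by
  rw [expVal_pauliState, expVal_maxMixed_pauliString, pauliCoeff, trace_pauliString_mul_self,
    ← Complex.ofReal_ofNat, ← Complex.ofReal_pow, Complex.ofReal_re]
  simp

/-! ### Executions against uninformative oracles -/

/-- The oracle that answers with the expectation values of `σ` where this is admissible for the
state `ρ`, and exactly otherwise. -/
noncomputable def maskedOracle {n : ℕ} (σ ρ : QubitOp n) (Q : QStatQuery n) : ℝ :=
  open Classical in
  if |expVal Q.obs σ - expVal Q.obs ρ| ≤ Q.tol then expVal Q.obs σ else expVal Q.obs ρ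

theorem isQStatOracle_maskedOracle {n : ℕ} (σ ρ : QubitOp n) :
    IsQStatOracle ρ (maskedOracle σ ρ) := fun Q => by
  unfold maskedOracle
  split_ifs with h
  · exact h
  · simpa using Q.tol_nonneg

theorem isQStatOracle_expVal {n : ℕ} (ρ : QubitOp n) :
    IsQStatOracle ρ fun Q => expVal Q.obs ρ := fun Q => by
  simpa using Q.tol_nonneg

theorem QSQTree.run_congr {n : ℕ} {α : Type} {r r' : QStatQuery n → ℝ} (t : QSQTree n α)
    (h : ∀ Q ∈ t.queries r, r' Q = r Q) : t.run r' = t.run r := by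
  induction t with
  | output a => rfl
  | query Q next ih =>
    simp only [queries, List.mem_cons, forall_eq_or_imp] at h
    simp only [run, h.1]
    exact ih _ h.2

theorem sq_mul_card_pauliCoeff_le {n : ℕ} {τ : ℝ} (hτ : 0 < τ) (L : List (QStatQuery n)) :
    τ ^ 2 * (Nat.card {P : NonIdPauli n // ∃ Q ∈ L, τ < |pauliCoeff Q.obs P|} : ℝ) ≤
      L.length := by
  classical
  simp only [Nat.card_eq_fintype_card, Fintype.card_subtype]
  induction L with
  | nil => simp
  | cons Q L ih =>
    have hQ : τ ^ 2 * ((Finset.univ.filter fun P : NonIdPauli n =>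
        τ < |pauliCoeff Q.obs P|).card : ℝ) ≤ 1 := by
      refine le_trans ?_ (sum_sq_pauliCoeff_le_one Q.obs_norm_le)
      rw [mul_comm, ← nsmul_eq_mul]
      refine (Finset.card_nsmul_le_sum _ (fun P => pauliCoeff Q.obs P ^ 2) _ fun P hP => ?_).trans
        (Finset.sum_le_univ_sum_of_nonneg fun P => sq_nonneg _)
      rw [← sq_abs (pauliCoeff Q.obs P)]
      exact pow_le_pow_left₀ hτ.le (Finset.mem_filter.1 hP).2.le 2
    simp only [List.mem_cons, exists_eq_or_imp, Finset.filter_or, List.length_cons, Nat.cast_add,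
      Nat.cast_one]
    calc _ ≤ τ ^ 2 * (((Finset.univ.filter fun P : NonIdPauli n =>
          τ < |pauliCoeff Q.obs P|).card : ℝ) + ((Finset.univ.filter fun P : NonIdPauli n =>
          ∃ R ∈ L, τ < |pauliCoeff R.obs P|).card : ℝ)) := by
          gcongr
          exact_mod_cast Finset.card_union_le _ _
      _ ≤ _ := by linarith

theorem sq_mul_card_run_ne_le {n : ℕ} {α : Type} {τ : ℝ} (hτ : 0 < τ) (t : QSQTree n α)
    (ht : ∀ Q ∈ t.queries (fun Q => expVal Q.obs (maxMixed n)), τ ≤ Q.tol) :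
    τ ^ 2 * (Nat.card {P : NonIdPauli n // t.run (maskedOracle (maxMixed n) (pauliState P)) ≠
      t.run fun Q => expVal Q.obs (maxMixed n)} : ℝ) ≤
      (t.queries fun Q => expVal Q.obs (maxMixed n)).length := by
  refine le_trans ?_ (sq_mul_card_pauliCoeff_le hτ _)
  gcongr
  refine Nat.card_mono (Set.toFinite _) fun P hP => ?_
  by_contra hcon
  refine hP (t.run_congr fun Q hQ => if_pos ?_)
  rw [expVal_pauliState, sub_add_cancel_left, abs_neg]
  exact (not_lt.1 fun h => hcon ⟨Q, hQ, h⟩).trans (ht Q hQ)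

/-! ### Averaging over the hypotheses -/

/-- If every `E i` and `F` are unlikely, but outside `F` all except `K` of the `E i` occur, then
there are few indices. The sets need not be measurable. -/
theorem card_le_of_forall_measure_le {Ω ι : Type*} [Fintype ι] [MeasurableSpace Ω]
    (ν : Measure Ω) [IsProbabilityMeasure ν] {E : ι → Set Ω} {F : Set Ω} {δ K : ℝ} (hδ : 0 ≤ δ)
    (hK : 0 ≤ K) (hE : ∀ i, ν (E i) ≤ ENNReal.ofReal δ) (hF : ν F ≤ ENNReal.ofReal δ)
    (h : ∀ ω ∉ F, (Nat.card {i // ω ∉ E i} : ℝ) ≤ K) :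
    (Fintype.card ι : ℝ) ≤ K + 2 * Fintype.card ι * δ := by
  classical
  -- Measurable hulls make the integral below additive.
  have hpt : ∀ ω, (Fintype.card ι : ENNReal) ≤ ENNReal.ofReal K +
      (Fintype.card ι * (toMeasurable ν F).indicator 1 ω +
        ∑ i, (toMeasurable ν (E i)).indicator 1 ω) := fun ω => by
    by_cases hω : ω ∈ F
    · rw [Set.indicator_of_mem (subset_toMeasurable ν F hω), Pi.one_apply, mul_one]
      exact le_add_left le_self_add
    · have h1 : (Nat.card {i // ω ∉ E i} : ENNReal) ≤ ENNReal.ofReal K := by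
        rw [← ENNReal.ofReal_natCast]
        exact ENNReal.ofReal_le_ofReal (h ω hω)
      have h2 : (Nat.card {i // ω ∈ E i} : ENNReal) ≤
          ∑ i, (toMeasurable ν (E i)).indicator 1 ω := by
        rw [Nat.card_eq_fintype_card, Fintype.card_subtype, Finset.card_filter, Nat.cast_sum]
        refine Finset.sum_le_sum fun i _ => ?_
        split_ifs with hi
        · rw [Set.indicator_of_mem (subset_toMeasurable ν _ hi)]
          simp
        · simp
      have h3 : (Fintype.card ι : ENNReal) =
          Nat.card {i // ω ∉ E i} + Nat.card {i // ω ∈ E i} := by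
        rw [Nat.card_eq_fintype_card, Nat.card_eq_fintype_card, Fintype.card_subtype_compl,
          ← Nat.cast_add, Nat.sub_add_cancel (Fintype.card_subtype_le _)]
      rw [h3]
      exact add_le_add h1 (h2.trans le_add_self)
  have hint := lintegral_mono (μ := ν) hpt
  have hm : ∀ s : Set Ω, Measurable ((toMeasurable ν s).indicator (1 : Ω → ENNReal)) := fun s =>
    measurable_one.indicator (measurableSet_toMeasurable ν s)
  rw [lintegral_const, measure_univ, mul_one, lintegral_add_left measurable_const,
    lintegral_const, measure_univ, mul_one, lintegral_add_left ((hm F).const_mul _),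
    lintegral_const_mul _ (hm F), lintegral_indicator_one (measurableSet_toMeasurable ν F),
    lintegral_finsetSum _ fun i _ => hm (E i), measure_toMeasurable] at hint
  simp only [lintegral_indicator_one (measurableSet_toMeasurable ν _), measure_toMeasurable]
    at hint
  have hfin : (Fintype.card ι : ENNReal) ≤ ENNReal.ofReal K +
      (Fintype.card ι * ENNReal.ofReal δ + Fintype.card ι * ENNReal.ofReal δ) := by
    refine hint.trans ?_
    gcongr
    refine (Finset.sum_le_sum fun i _ => hE i).trans ?_
    simp
  rw [← ENNReal.ofReal_natCast, ← ENNReal.ofReal_mul (by positivity),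
    ← ENNReal.ofReal_add (by positivity) (by positivity),
    ← ENNReal.ofReal_add (by positivity) (by positivity),
    ENNReal.ofReal_le_ofReal_iff (by positivity)] at hfin
  linarith

/-! ### The lower bound -/

theorem mainTheorem2 (δ : ℝ) (hδ0 : 0 < δ) (hδ1 : δ < 1 / 2) :
    ∃ c : ℝ, 0 < c ∧
      ∀ (n : ℕ), 1 ≤ n →
      ∀ (τ ε : ℝ), 0 < τ → 0 < ε → ε < 1 / 2 →
      ∀ (Ω : Type*) [MeasurableSpace Ω] (ν : Measure Ω) [IsProbabilityMeasure ν]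
        (A : Thresholds n → Ω → QSQTree n (ThresholdOutput n)) (q : ℕ),
        HasToleranceAtLeast τ A →
        MakesAtMostQueries q A →
        SolvesThresholdSearch ν ε δ A →
        c * (τ ^ 2 * 2 ^ (2 * n) / n) ≤ q := by
  -- The factor `3 / 4` is for `4 ^ n - 1 ≥ 3 / 4 * 4 ^ n`.
  refine ⟨3 / 4 * (1 - 2 * δ), by linarith, ?_⟩
  intro n hn τ ε hτ hε0 hε1 Ω _ ν _ A q hT hq hS
  set θ : Thresholds n := fun _ => 0
  set r₀ : QStatQuery n → ℝ := fun Q => expVal Q.obs (maxMixed n)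
  have hr₀ : IsQStatOracle (maxMixed n) r₀ := isQStatOracle_expVal _
  have hcard : (Fintype.card (NonIdPauli n) : ℝ) ≤
      q / τ ^ 2 + 2 * Fintype.card (NonIdPauli n) * δ := by
    refine card_le_of_forall_measure_le ν hδ0.le (by positivity)
      (fun P => hS θ _ (isQState_pauliState P) _
        (isQStatOracle_maskedOracle (maxMixed n) (pauliState P)))
      (hS θ _ (isQState_maxMixed n) r₀ hr₀) fun ω hω => ?_
    have hrun : (A θ ω).run r₀ = .allClose := by
      have htrue := not_not.1 hω
      cases hout : (A θ ω).run r₀ with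
      | allClose => rfl
      | deviates j μ =>
        rw [hout] at htrue
        have h := htrue.1
        rw [expVal_maxMixed_pauliString] at h
        simp only [θ, Set.Icc.coe_zero, sub_self, abs_zero] at h
        linarith
    rw [le_div_iff₀' (by positivity)]
    have hlen : (((A θ ω).queries r₀).length : ℝ) ≤ q :=
      mod_cast hq θ ω _ (isQState_maxMixed n) r₀ hr₀
    refine le_trans ?_ ((sq_mul_card_run_ne_le hτ (A θ ω)
      (hT θ ω _ (isQState_maxMixed n) r₀ hr₀)).trans hlen)
    gcongr
    refine Nat.card_mono (Set.toFinite _) fun P hP heq => ?_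
    have htrue := not_not.1 hP
    rw [heq, hrun] at htrue
    have h := htrue P
    rw [expVal_pauliState_pauliString] at h
    simp only [θ, Set.Icc.coe_zero, sub_zero, abs_one] at h
    linarith
  have hN : 3 / 4 * (2 : ℝ) ^ (2 * n) ≤ Fintype.card (NonIdPauli n) := by
    have h4 : (4 : ℝ) ≤ 4 ^ n := le_self_pow₀ (by norm_num) (by lia)
    rw [card_nonIdPauli, Nat.cast_sub (Nat.one_le_pow _ _ (by norm_num)), pow_mul]
    push_cast
    norm_num
    linarith
  have hn1 : (1 : ℝ) ≤ n := mod_cast hn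
  calc _ ≤ 3 / 4 * (1 - 2 * δ) * (τ ^ 2 * 2 ^ (2 * n)) := by
        refine mul_le_mul_of_nonneg_left (div_le_self (by positivity) hn1) (by linarith)
    _ = τ ^ 2 * ((1 - 2 * δ) * (3 / 4 * 2 ^ (2 * n))) := by ring
    _ ≤ τ ^ 2 * ((1 - 2 * δ) * Fintype.card (NonIdPauli n)) := by
        have : 0 ≤ 1 - 2 * δ := by linarith
        gcongr
    _ ≤ τ ^ 2 * (q / τ ^ 2) := by
        gcongr
        linarith
    _ = q := by field_simp
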